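/- **Conventions.** All Hilbert spaces are complex. A Hilbert space $\mathcal H_+$ is *closely embedded* in a Hilbert space $\mathcal H$ if there is a linear manifold $\mathcal D\subseteq\mathcal H_+\cap\mathcal H$ (on which the two linear structures agree), dense in $\mathcal H_+$, such that the embedding operator $j_+x=x$, $\operatorname{Dom}(j_+)=\mathcal D$, is closed as an operator from $\mathcal H_+$ to $\mathcal H$. A *triplet of closely embedded Hilbert spaces* $(\mathcal H_+;\mathcal H_0;\mathcal H_-)$ consists of Hilbert spaces such that $\mathcal H_+$ is closely embedded in $\mathcal H_0$ with closed embedding $j_+$ of dense range, $\mathcal H_0$ is closely embedded in $\mathcal H_-$ with closed embedding $j_-$ of dense range, $\operatorname{Dom}(j_+^*)\subseteq\operatorname{Dom}(j_-)$, and $$\|y\|_-=\sup\Bigl\{\frac{|\langle x,y\rangle_{\mathcal H_0}|}{\|x\|_+}\;\Big|\;x\in\operatorname{Dom}(j_+),\ x\neq0\Bigr\},\qquad y\in\operatorname{Dom}(j_-).$$ Suprema of sets of nonnegative numbers are taken in $[0,\infty)$, so $\sup\emptyset=0$. The operator $H=(j_+j_+^*)^{-1}$ in $\mathcal H_0$ is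 the *Hamiltonian* of the triplet. For a closed densely defined operator $T$ from a Hilbert space $\mathcal H$ to a Hilbert space $\mathcal G$, $\mathcal D(T)$ is the completion of $\operatorname{Dom}(T)\ominus\ker(T)$ with respect to the inner product $(x,y)_T=\langle Tx,Ty\rangle_{\mathcal G}$, with embedding operator $i_T\colon\mathcal D(T)\to\mathcal H$, $i_Tx=x$ for $x\in\operatorname{Dom}(i_T)=\operatorname{Dom}(T)\ominus\ker(T)$; and $\mathcal R(T)$ is the completion of $\operatorname{Ran}(T)$ with respect to the inner product $\langle Tx,Ty\rangle_T=\langle x,y\rangle_{\mathcal H}$ for $x,y\in\operatorname{Dom}(T)\ominus\ker(T)$, with embedding operator $j_T\colon\mathcal R(T)\to\mathcal G$, $j_Tu=u$ for $u\in\operatorname{Dom}(j_T)=\operatorname{Ran}(T)$. **Theorem.** Let $H$ be an arbitrary positive selfadjoint operator (that is, $\langle Hx,x\rangle\ge0$ for all $x\in\operatorname{Dom}(H)$) in a Hilbert space $\mathcal H_0$ for which $0$ is not an eigenvalue, and let $H^{1/2}$ be its square root, i.e. the positive selfadjoint operator with $H^{1/2}H^{1/2}=H$ (domains included), which exists. (1)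 $(\mathcal D(H^{1/2});\mathcal H_0;\mathcal R(H^{1/2}))$ is a triplet of closely embedded Hilbert spaces, with closed embeddings $j_+=i_{H^{1/2}}$ and $j_-=j_{H^{1/2}}^{-1}$, and its Hamiltonian is $H$. (2) Let $(\mathcal H_+;\mathcal H_0;\mathcal H_-)$ be any triplet of closely embedded Hilbert spaces with the same Hamiltonian $H$, and let $j_+$ denote the closed embedding of $\mathcal H_+$ in $\mathcal H_0$. Then: (a) $\operatorname{Dom}(H^{1/2})$ is (contained and) dense in both $\mathcal D(H^{1/2})$ and $\mathcal H_+$. (b) For any $x\in\operatorname{Dom}(H^{1/2})$ and any $y\in\operatorname{Dom}(H)$ we have $\langle x,Hy\rangle_{\mathcal H_0}=\langle x,y\rangle_+=(x,y)_{H^{1/2}}$. (c) $\operatorname{Dom}(H)$ is (contained and) dense in both $\mathcal D(H^{1/2})$ and $\mathcal H_+$. (d) $\operatorname{Dom}(j_+)=\operatorname{Dom}(H^{1/2})$, and for any $x\in\operatorname{Dom}(j_+)$ we have $$\|x\|_+=\sup\Bigl\{\frac{|\langle x,H^{1/2}z\rangle_{\mathcal H_0}|}{\|z\|_{\mathcal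 H_0}}\;\Big|\;z\in\operatorname{Dom}(H^{1/2}),\ z\neq0\Bigr\}.$$ (e) There is a unitary operator $\Phi_+\colon\mathcal D(H^{1/2})\to\mathcal H_+$ that extends the identity operator on $\operatorname{Dom}(H)$, regarded as an operator from $\mathcal D(H^{1/2})$ to $\mathcal H_+$; it is the only bounded linear operator $\mathcal D(H^{1/2})\to\mathcal H_+$ extending it; and for all $y\in\operatorname{Dom}(H)$ we have $Hy\in\operatorname{Dom}(j_+^*)$ and $\Phi_+y=j_+^*Hy$. -/

import Mathlib

open scoped NNReal

noncomputable section

namespace CloseEmb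

open UniformSpace

variable {E F G : Type*}
  [NormedAddCommGroup E] [InnerProductSpace ℂ E]
  [NormedAddCommGroup F] [InnerProductSpace ℂ F]
  [NormedAddCommGroup G] [InnerProductSpace ℂ G]

/-! ### Composition and square roots of unbounded operators -/

/-- The composition `g ∘ f` of two partially defined operators, with its natural domain
`{x ∈ Dom f | f x ∈ Dom g}`. -/
def pcomp (g : F →ₗ.[ℂ] G) (f : E →ₗ.[ℂ] F) : E →ₗ.[ℂ] G :=
  g.comp (f.domRestrict ((g.domain.comap f.toFun).map f.domain.subtype)) (by
    rintro ⟨x, hx, hx'⟩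
    obtain ⟨z, hz, rfl⟩ := hx
    exact hz)

theorem mem_pcomp_domain {g : F →ₗ.[ℂ] G} {f : E →ₗ.[ℂ] F} {x : E} :
    x ∈ (pcomp g f).domain ↔ ∃ h : x ∈ f.domain, f ⟨x, h⟩ ∈ g.domain := by
  constructor
  · rintro ⟨⟨z, hz, rfl⟩, h⟩
    exact ⟨h, hz⟩
  · rintro ⟨h, h'⟩
    exact ⟨⟨⟨x, h⟩, h', rfl⟩, h⟩

theorem pcomp_apply {g : F →ₗ.[ℂ] G} {f : E →ₗ.[ℂ] F} {x : E} (hx : x ∈ (pcomp g f).domain)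
    (h : x ∈ f.domain) (h' : f ⟨x, h⟩ ∈ g.domain) :
    pcomp g f ⟨x, hx⟩ = g ⟨f ⟨x, h⟩, h'⟩ := rfl

/-- `T` is a positive selfadjoint operator in the Hilbert space `E` (selfadjointness includes
that `T` is densely defined, and positivity means `⟨T x, x⟩ ≥ 0` on `Dom T`). -/
def IsPositiveSelfadjoint [CompleteSpace E] (T : E →ₗ.[ℂ] E) : Prop :=
  IsSelfAdjoint T ∧ ∀ x : T.domain, 0 ≤ (inner ℂ (T x) (x : E)).re

/-- `0` is not an eigenvalue of `T`. -/
def ZeroNotEigenvalue (T : E →ₗ.[ℂ] E) : Prop :=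
  ∀ x : T.domain, T x = 0 → (x : E) = 0

/-- `S` is a positive selfadjoint operator with `S ∘ S = H`, domains included. -/
def IsPositiveSqrt [CompleteSpace E] (H S : E →ₗ.[ℂ] E) : Prop :=
  IsPositiveSelfadjoint S ∧ pcomp S S = H

/-- The square root `H^{1/2}`: the positive selfadjoint operator whose square is `H`
(for a positive selfadjoint `H` there is exactly one). -/
def sqrt [CompleteSpace E] (H : E →ₗ.[ℂ] E) : E →ₗ.[ℂ] E :=
  Classical.epsilon (IsPositiveSqrt H)

/-! ### Closed embeddings, triplets, kernel operator and Hamiltonian -/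

/-- `E` is closely embedded in `F` by means of the embedding operator `j`. The linear manifold
common to `E` and `F` is presented through its copy `Dom j` in `E` and its copy `Ran j` in `F`,
and `j` is the identification of the two copies: it is linear and one-to-one, its domain is dense
in `E`, and it is closed as an operator from `E` to `F`. -/
structure IsCloseEmbedding (j : E →ₗ.[ℂ] F) : Prop where
  injective : Function.Injective j
  dense_domain : Dense (j.domain : Set E)
  closed : j.IsClosed

variable {Hp H₀ Hm : Type*}
  [NormedAddCommGroup Hp] [InnerProductSpace ℂ Hp] [CompleteSpace Hp]
  [NormedAddCommGroup H₀] [InnerProductSpace ℂ H₀] [CompleteSpace H₀]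
  [NormedAddCommGroup Hm] [InnerProductSpace ℂ Hm] [CompleteSpace Hm]

/-- `(Hp; H₀; Hm)` is a triplet of closely embedded Hilbert spaces, with closed embeddings
`jp` of `Hp` in `H₀` and `jm` of `H₀` in `Hm`. For `y ∈ Dom jm` the norm of `y` in `Hm` is
`‖jm y‖`; the supremum is taken in `[0, ∞)`, so that the supremum of the empty set is `0`. -/
structure IsTriplet (jp : Hp →ₗ.[ℂ] H₀) (jm : H₀ →ₗ.[ℂ] Hm) : Prop where
  plus_embedding : IsCloseEmbedding jp
  plus_dense_range : Dense (Set.range jp)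
  minus_embedding : IsCloseEmbedding jm
  minus_dense_range : Dense (Set.range jm)
  adjoint_domain_le : jp.adjoint.domain ≤ jm.domain
  dual_norm : ∀ y : jm.domain,
    IsLUB {r : ℝ≥0 | ∃ x : jp.domain, (x : Hp) ≠ 0 ∧
      r = ‖inner ℂ (jp x) (y : H₀)‖₊ / ‖(x : Hp)‖₊} ‖jm y‖₊

/-- The kernel operator `A = j j^*` of a closed embedding `j`. -/
def kernelOperator (jp : Hp →ₗ.[ℂ] H₀) : H₀ →ₗ.[ℂ] H₀ := pcomp jp jp.adjoint

/-- The Hamiltonian `A⁻¹` of a triplet whose left-hand closed embedding is `jp`. -/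
def hamiltonian (jp : Hp →ₗ.[ℂ] H₀) : H₀ →ₗ.[ℂ] H₀ := (kernelOperator jp).inverse

/-- The linear manifold `M` of `F` is dense in the space `E` which is closely embedded in `F` by
`j`: every element of `M` belongs to the common part of `E` and `F`, and `M`, regarded as a
subset of `E`, is dense in `E`. -/
def IsDenseVia (j : E →ₗ.[ℂ] F) (M : Submodule ℂ F) : Prop :=
  (M : Set F) ⊆ Set.range j ∧ Dense {x : E | ∃ h : x ∈ j.domain, j ⟨x, h⟩ ∈ M}

/-! ### The Hilbert spaces `𝒟(T)` and `ℛ(T)` -/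

/-- The null space of `T`, as a linear submanifold of `E`. -/
def nullSpace (T : E →ₗ.[ℂ] F) : Submodule ℂ E :=
  (LinearMap.ker T.toFun).map T.domain.subtype

/-- The linear manifold `Dom T ⊖ ker T`. -/
def coDomain (T : E →ₗ.[ℂ] F) : Submodule ℂ E := T.domain ⊓ (nullSpace T)ᗮ

/-- The restriction of `T` to `Dom T ⊖ ker T`. -/
def coRestrict (T : E →ₗ.[ℂ] F) : coDomain T →ₗ[ℂ] F :=
  T.toFun ∘ₗ Submodule.inclusion inf_le_left

theorem coRestrict_injective (T : E →ₗ.[ℂ] F) : Function.Injective (coRestrict T) := by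
  rw [injective_iff_map_eq_zero]
  rintro ⟨x, hx, hx'⟩ h
  have hk : x ∈ nullSpace T := ⟨⟨x, hx⟩, h, rfl⟩
  have : x ∈ nullSpace T ⊓ (nullSpace T)ᗮ := ⟨hk, hx'⟩
  rw [Submodule.inf_orthogonal_eq_bot, Submodule.mem_bot] at this
  exact Subtype.ext this

/-- The manifold `Dom T ⊖ ker T`, to be normed by `|x|_T = ‖T x‖`. -/
def DPre (T : E →ₗ.[ℂ] F) : Type _ := coDomain T

instance (T : E →ₗ.[ℂ] F) : AddCommGroup (DPre T) := inferInstanceAs (AddCommGroup (coDomain T))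

instance (T : E →ₗ.[ℂ] F) : Module ℂ (DPre T) := inferInstanceAs (Module ℂ (coDomain T))

/-- The inclusion of `Dom T ⊖ ker T` in `E`. -/
def DPre.incl (T : E →ₗ.[ℂ] F) : DPre T →ₗ[ℂ] E := (coDomain T).subtype

/-- `T` on `Dom T ⊖ ker T`. -/
def DPre.map (T : E →ₗ.[ℂ] F) : DPre T →ₗ[ℂ] F := coRestrict T

/-- The inner product `(x, y)_T = ⟨T x, T y⟩` on `Dom T ⊖ ker T`. -/
@[reducible] def DPre.core (T : E →ₗ.[ℂ] F) : InnerProductSpace.Core ℂ (DPre T) where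
  inner x y := inner ℂ (DPre.map T x) (DPre.map T y)
  conj_inner_symm x y := inner_conj_symm _ _
  re_inner_nonneg x := inner_self_nonneg
  add_left x y z := by rw [map_add, inner_add_left]
  smul_left x y r := by rw [map_smul, inner_smul_left]
  definite x hx := by
    have h : DPre.map T x = 0 := inner_self_eq_zero.mp hx
    exact coRestrict_injective T (h.trans (map_zero (coRestrict T)).symm)

instance (T : E →ₗ.[ℂ] F) : NormedAddCommGroup (DPre T) :=
  @InnerProductSpace.Core.toNormedAddCommGroup ℂ (DPre T) _ _ _ (DPre.core T)

instance (T : E →ₗ.[ℂ] F) : InnerProductSpace ℂ (DPre T) :=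
  InnerProductSpace.ofCore (DPre.core T).toCore

/-- The range of `T`, to be normed by `‖T x‖_T = ‖x‖` for `x ∈ Dom T ⊖ ker T`. It is written as
`T (Dom T ⊖ ker T)`, which is all of `Ran T` when `ker T` is closed. -/
def RPre (T : E →ₗ.[ℂ] F) : Type _ := LinearMap.range (coRestrict T)

instance (T : E →ₗ.[ℂ] F) : AddCommGroup (RPre T) :=
  inferInstanceAs (AddCommGroup (LinearMap.range (coRestrict T)))

instance (T : E →ₗ.[ℂ] F) : Module ℂ (RPre T) :=
  inferInstanceAs (Module ℂ (LinearMap.range (coRestrict T)))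

/-- The inclusion of `Ran T` in `F`. -/
def RPre.incl (T : E →ₗ.[ℂ] F) : RPre T →ₗ[ℂ] F := (LinearMap.range (coRestrict T)).subtype

/-- The map that sends `u ∈ Ran T` to the unique `x ∈ Dom T ⊖ ker T` with `T x = u`. -/
def RPre.preimage (T : E →ₗ.[ℂ] F) : RPre T →ₗ[ℂ] E :=
  (coDomain T).subtype ∘ₗ
    (LinearEquiv.ofInjective (coRestrict T) (coRestrict_injective T)).symm.toLinearMap

theorem RPre.preimage_injective (T : E →ₗ.[ℂ] F) : Function.Injective (RPre.preimage T) :=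
  (coDomain T).subtype_injective.comp (LinearEquiv.injective _)

/-- The inner product `⟨T x, T y⟩_T = ⟨x, y⟩`, `x, y ∈ Dom T ⊖ ker T`, on `Ran T`. -/
@[reducible] def RPre.core (T : E →ₗ.[ℂ] F) : InnerProductSpace.Core ℂ (RPre T) where
  inner u v := inner ℂ (RPre.preimage T u) (RPre.preimage T v)
  conj_inner_symm x y := inner_conj_symm _ _
  re_inner_nonneg x := inner_self_nonneg
  add_left x y z := by rw [map_add, inner_add_left]
  smul_left x y r := by rw [map_smul, inner_smul_left]
  definite x hx := by
    have h : RPre.preimage T x = 0 := inner_self_eq_zero.mp hx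
    exact RPre.preimage_injective T (h.trans (map_zero (RPre.preimage T)).symm)

instance (T : E →ₗ.[ℂ] F) : NormedAddCommGroup (RPre T) :=
  @InnerProductSpace.Core.toNormedAddCommGroup ℂ (RPre T) _ _ _ (RPre.core T)

instance (T : E →ₗ.[ℂ] F) : InnerProductSpace ℂ (RPre T) :=
  InnerProductSpace.ofCore (RPre.core T).toCore

/-- The Hilbert space `𝒟(T)`, the completion of `Dom T ⊖ ker T` under `|x|_T = ‖T x‖`. -/
abbrev DSpace (T : E →ₗ.[ℂ] F) : Type _ := Completion (DPre T)

/-- The Hilbert space `ℛ(T)`, the completion of `Ran T` under `‖T x‖_T = ‖x‖`, `x ⊥ ker T`. -/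
abbrev RSpace (T : E →ₗ.[ℂ] F) : Type _ := Completion (RPre T)

/-- A linear map `ι` on a pre-Hilbert space `V`, regarded as an operator on the completion of `V`
with domain `V`. -/
def onCompletion (ι : E →ₗ[ℂ] F) : Completion E →ₗ.[ℂ] F where
  domain := LinearMap.range (Completion.toComplₗᵢ (𝕜 := ℂ) (E := E)).toLinearMap
  toFun := ι ∘ₗ (LinearEquiv.ofInjective (Completion.toComplₗᵢ (𝕜 := ℂ) (E := E)).toLinearMap
    (Completion.toComplₗᵢ (𝕜 := ℂ) (E := E)).injective).symm.toLinearMap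

/-- The embedding operator `i_T` from `𝒟(T)` to `E`: `i_T x = x` for `x ∈ Dom T ⊖ ker T`. -/
def iEmb (T : E →ₗ.[ℂ] F) : DSpace T →ₗ.[ℂ] E := onCompletion (DPre.incl T)

/-- The embedding operator `j_T` from `ℛ(T)` to `F`: `j_T u = u` for `u ∈ Ran T`. -/
def jEmb (T : E →ₗ.[ℂ] F) : RSpace T →ₗ.[ℂ] F := onCompletion (RPre.incl T)

end CloseEmb

end

noncomputable section

namespace CloseEmb

open UniformSpace

/-! ### Cores of `T^* T` and comparison of closed operators through their graphs. -/

section Relation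

variable {E F F' : Type*}
  [NormedAddCommGroup E] [InnerProductSpace ℂ E]
  [NormedAddCommGroup F] [InnerProductSpace ℂ F]
  [NormedAddCommGroup F'] [InnerProductSpace ℂ F']

/-! Let `j` be a closed embedding with dense range, and put `T = j⁻¹`, a closed operator from `H₀`
to `Hp`. The Hamiltonian `(j j^*)⁻¹` is then `T^* T`, while for the square root `S` it is `S^* S`.
So both parts reduce to comparing closed operators with the same `T^* T`.

On `Dom (T^* T)` the norm `‖T x‖² = ⟨x, T^* T x⟩` depends only on `T^* T`, and this manifold is a
core of `T` (`mem_closure_adjCore`). Passing to the closure, an inclusion `T^* T ⊆ S^* S` yields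
`Dom T ⊆ Dom S` with equal norms (`exists_norm_eq_of_adjCompSelf_imp`). Used in both directions,
this gives `Ran j = Dom S` and `‖u‖ = ‖S (j u)‖`. The density statements, the supremum formula and
the unitary operator follow, the last because `i_S` and `j` have the same range and induce the same
norm on it.

For the existence of `S`, take the resolvent `A = (1 + H)⁻¹` and the bounded square roots `B` of `A`
and `C` of `1 - A`. Then `S = C B⁻¹`, with graph `{(B t, C t)}`. The model triplet is read off from
the graph of `S`: up to the isometric extensions of `S` and `S⁻¹` to the completions, `i_S` is `S⁻¹`
and `j_S` is `S`. -/

theorem norm_eq_of_inner_eq {G : Submodule ℂ (E × F)} {G' : Submodule ℂ (E × F')}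
    {y z : E} {l : F} {l' : F'} (h : (y, l) ∈ G)
    (hz : ∀ a b, (a, b) ∈ G → inner ℂ b l = inner ℂ a z) (h' : (y, l') ∈ G')
    (hz' : ∀ a b, (a, b) ∈ G' → inner ℂ b l' = inner ℂ a z) : ‖l'‖ = ‖l‖ := by
  have : inner ℂ l' l' = inner ℂ l l := (hz' _ _ h').trans (hz _ _ h).symm
  rw [norm_eq_sqrt_re_inner (𝕜 := ℂ), norm_eq_sqrt_re_inner (𝕜 := ℂ), this]

/-- Membership of `(x, z)` in the graph of `T^* T`, where `G` is the graph of `T`. -/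
def AdjCompSelf (G : Submodule ℂ (E × F)) (x z : E) : Prop :=
  ∃ k, (x, k) ∈ G ∧ ∀ a b, (a, b) ∈ G → inner ℂ b k = inner ℂ a z

/-- The part of the graph `G` of `T` that lies over `Dom (T^* T)`. -/
def adjCore (G : Submodule ℂ (E × F)) : Submodule ℂ (E × F) where
  carrier := {p | p ∈ G ∧ ∃ z, ∀ a b, (a, b) ∈ G → inner ℂ b p.2 = inner ℂ a z}
  zero_mem' := ⟨G.zero_mem, 0, fun a b _ => by simp⟩
  add_mem' := by
    rintro p q ⟨hp, z, hz⟩ ⟨hq, w, hw⟩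
    exact ⟨G.add_mem hp hq, z + w, fun a b h => by
      rw [Prod.snd_add, inner_add_right, inner_add_right, hz a b h, hw a b h]⟩
  smul_mem' := by
    rintro c p ⟨hp, z, hz⟩
    exact ⟨G.smul_mem c hp, c • z, fun a b h => by
      rw [Prod.smul_snd, inner_smul_right, inner_smul_right, hz a b h]⟩

variable [CompleteSpace E] [CompleteSpace F] [CompleteSpace F']

/-- Orthogonal decomposition along a closed subspace of a product. -/
theorem exists_mem_forall_inner_add_eq_zero (G : Submodule ℂ (E × F))
    (hG : IsClosed (G : Set (E × F))) (p : E × F) :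
    ∃ q ∈ G, ∀ a b, (a, b) ∈ G → inner ℂ a (p.1 - q.1) + inner ℂ b (p.2 - q.2) = 0 := by
  -- The product carries the maximum norm; the projection theorem needs the Hilbert norm, which has
  -- the same topology.
  let G₂ : Submodule ℂ (WithLp 2 (E × F)) :=
    G.comap (WithLp.linearEquiv 2 ℂ (E × F)).toLinearMap
  have hG₂ : IsClosed (G₂ : Set (WithLp 2 (E × F))) :=
    hG.preimage (WithLp.prod_continuous_ofLp 2 E F)
  have : CompleteSpace G₂ := hG₂.completeSpace_coe
  obtain ⟨y, hy, z, hz, hp⟩ := G₂.exists_add_mem_mem_orthogonal (WithLp.toLp 2 p)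
  refine ⟨y.ofLp, hy, fun a b hab => ?_⟩
  have h := hz (WithLp.toLp 2 (a, b)) hab
  have hz' : z = WithLp.toLp 2 p - y := by rw [hp]; abel
  rw [hz', WithLp.prod_inner_apply] at h
  exact h

/-- `Dom (T^* T)` is a core of the closed operator `T` with graph `G`. -/
theorem mem_closure_adjCore (G : Submodule ℂ (E × F)) (hG : IsClosed (G : Set (E × F)))
    (hfun : ∀ k, ((0 : E), k) ∈ G → k = 0) {p : E × F} (hp : p ∈ G) :
    p ∈ closure (adjCore G : Set (E × F)) := by
  have hle : (adjCore G).topologicalClosure ≤ G :=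
    Submodule.topologicalClosure_minimal _ (fun q hq => hq.1) hG
  obtain ⟨q, hq, hort⟩ := exists_mem_forall_inner_add_eq_zero (adjCore G).topologicalClosure
    (Submodule.isClosed_topologicalClosure _) p
  have hqG : p - q ∈ G := G.sub_mem hp (hle hq)
  -- With `h = p.1 - q.1`, projecting `(h, 0)` on the graph solves `y + T^* T y = h`, so `(y, T y)`
  -- lies in the core.
  obtain ⟨⟨y, l⟩, hyl, hy⟩ := exists_mem_forall_inner_add_eq_zero G hG (p.1 - q.1, 0)
  have hcore : ∀ a b, (a, b) ∈ G → inner ℂ b l = inner ℂ a (p.1 - q.1 - y) := fun a b hab => by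
    have := hy a b hab
    simp only [zero_sub, inner_neg_right] at this
    exact (eq_of_sub_eq_zero (by rw [sub_eq_add_neg]; exact this)).symm
  have h1 := hort y l (Submodule.le_topologicalClosure _ ⟨hyl, _, hcore⟩)
  have h2 := hcore (p.1 - q.1) (p.2 - q.2) hqG
  have h3 : inner ℂ l (p.2 - q.2) = inner ℂ (p.1 - q.1 - y) (p.1 - q.1) := by
    rw [← inner_conj_symm, h2, inner_conj_symm]
  -- Orthogonality of `p - q` to `(y, T y)` reads `⟨y, h⟩ + ⟨h - y, h⟩ = ‖h‖² = 0`.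
  rw [h3, ← inner_add_left, add_sub_cancel] at h1
  have h4 : p.1 - q.1 = 0 := inner_self_eq_zero.mp h1
  have h5 : p.2 - q.2 = 0 := hfun _ (by rw [← h4]; exact hqG)
  have : p = q := Prod.ext (sub_eq_zero.mp h4) (sub_eq_zero.mp h5)
  rw [this]
  exact hq

/-- If `T^* T ⊆ S^* S` for closed operators `T` and `S`, then `Dom T ⊆ Dom S` and
`‖S x‖ = ‖T x‖` on `Dom T`. -/
theorem exists_norm_eq_of_adjCompSelf_imp (G : Submodule ℂ (E × F)) (G' : Submodule ℂ (E × F'))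
    (hG : IsClosed (G : Set (E × F))) (hG' : IsClosed (G' : Set (E × F')))
    (hfun : ∀ k, ((0 : E), k) ∈ G → k = 0)
    (himp : ∀ x z, AdjCompSelf G x z → AdjCompSelf G' x z) {x : E} {k : F} (h : (x, k) ∈ G) :
    ∃ k', (x, k') ∈ G' ∧ ‖k'‖ = ‖k‖ := by
  obtain ⟨p, hp, hlim⟩ := mem_closure_iff_seq_limit.mp (mem_closure_adjCore G hG hfun h)
  choose hpG z hz using hp
  have h1 := fun n => himp (p n).1 (z n) ⟨(p n).2, hpG n, hz n⟩
  choose l hl hlz using h1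
  have hlim1 : Filter.Tendsto (fun n => (p n).1) Filter.atTop (nhds x) :=
    (continuous_fst.tendsto _).comp hlim
  have hlim2 : Filter.Tendsto (fun n => (p n).2) Filter.atTop (nhds k) :=
    (continuous_snd.tendsto _).comp hlim
  have hnorm : ∀ n, ‖l n‖ = ‖(p n).2‖ := fun n =>
    norm_eq_of_inner_eq (hpG n) (hz n) (hl n) (hlz n)
  -- The equality of norms holds for differences by linearity, so convergence of `T x_n` makes `S
  -- x_n` a Cauchy sequence.
  have hdist : ∀ m n, dist (l m) (l n) = dist (p m).2 (p n).2 := fun m n => by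
    rw [dist_eq_norm, dist_eq_norm]
    refine norm_eq_of_inner_eq (z := z m - z n) (G.sub_mem (hpG m) (hpG n)) ?_
      (G'.sub_mem (hl m) (hl n)) ?_
    · intro a b hab
      rw [inner_sub_right, inner_sub_right, hz m a b hab, hz n a b hab]
    · intro a b hab
      rw [inner_sub_right, inner_sub_right, hlz m a b hab, hlz n a b hab]
  have hc : CauchySeq l := by
    rw [Metric.cauchySeq_iff]
    intro ε hε
    obtain ⟨N, hN⟩ := Metric.cauchySeq_iff.mp hlim2.cauchySeq ε hε
    exact ⟨N, fun m hm n hn => by rw [hdist]; exact hN m hm n hn⟩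
  obtain ⟨k', hk'⟩ := cauchySeq_tendsto_of_complete hc
  refine ⟨k', hG'.mem_of_tendsto (hlim1.prodMk_nhds hk') (Filter.Eventually.of_forall hl), ?_⟩
  refine tendsto_nhds_unique hk'.norm ?_
  simp_rw [hnorm]
  exact hlim2.norm

end Relation

/-! ### Existence of the square root -/

section Sqrt

variable {E : Type*} [NormedAddCommGroup E] [InnerProductSpace ℂ E] [CompleteSpace E]

theorem mem_graph_adjoint_iff {F : Type*} [NormedAddCommGroup F] [InnerProductSpace ℂ F]
    {T : E →ₗ.[ℂ] F} (hT : Dense (T.domain : Set E)) {y : F} {x : E} :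
    (y, x) ∈ T.adjoint.graph ↔ ∀ a b, (a, b) ∈ T.graph → inner ℂ b y = inner ℂ a x := by
  rw [LinearPMap.adjoint_graph_eq_graph_adjoint hT, Submodule.mem_adjoint_iff]
  simp only [sub_eq_zero]

/-- Since `T = T^*`, a pairing identity against the graph already forces `x` into the domain. -/
theorem mem_graph_iff_of_isSelfAdjoint {T : E →ₗ.[ℂ] E} (hT : IsSelfAdjoint T) {x y : E} :
    (x, y) ∈ T.graph ↔ ∀ a b, (a, b) ∈ T.graph → inner ℂ b x = inner ℂ a y := by
  rw [← mem_graph_adjoint_iff hT.dense_domain, LinearPMap.isSelfAdjoint_def.mp hT]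

theorem inner_eq_of_isSelfAdjoint {T : E →ₗ.[ℂ] E} (hT : IsSelfAdjoint T) {x y a b : E}
    (h : (x, y) ∈ T.graph) (h' : (a, b) ∈ T.graph) : inner ℂ b x = inner ℂ a y :=
  (mem_graph_iff_of_isSelfAdjoint hT).mp h a b h'

theorem isSelfAdjoint_of_mem_graph_iff {T : E →ₗ.[ℂ] E} (hd : Dense (T.domain : Set E))
    (h : ∀ x y, (x, y) ∈ T.graph ↔ ∀ a b, (a, b) ∈ T.graph → inner ℂ b x = inner ℂ a y) :
    IsSelfAdjoint T := by
  rw [LinearPMap.isSelfAdjoint_def]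
  apply LinearPMap.eq_of_eq_graph
  ext ⟨x, y⟩
  rw [mem_graph_adjoint_iff hd, h]

theorem mem_graph_pcomp_iff {E F G : Type*} [NormedAddCommGroup E] [InnerProductSpace ℂ E]
    [NormedAddCommGroup F] [InnerProductSpace ℂ F] [NormedAddCommGroup G] [InnerProductSpace ℂ G]
    {g : F →ₗ.[ℂ] G} {f : E →ₗ.[ℂ] F} {x : E} {z : G} :
    (x, z) ∈ (pcomp g f).graph ↔ ∃ y, (x, y) ∈ f.graph ∧ (y, z) ∈ g.graph := by
  simp only [LinearPMap.mem_graph_iff, Subtype.exists, exists_and_left, exists_eq_left]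
  constructor
  · rintro ⟨hx, rfl⟩
    obtain ⟨h, h'⟩ := mem_pcomp_domain.mp hx
    exact ⟨f ⟨x, h⟩, ⟨h, rfl⟩, h', (pcomp_apply hx h h').symm⟩
  · rintro ⟨y, ⟨h, rfl⟩, h', rfl⟩
    exact ⟨mem_pcomp_domain.mpr ⟨h, h'⟩, pcomp_apply _ h h'⟩

theorem re_inner_nonneg_of_mem_graph {H : E →ₗ.[ℂ] E} (hH : IsPositiveSelfadjoint H) {x y : E}
    (h : (x, y) ∈ H.graph) : 0 ≤ (inner ℂ x y).re := by
  obtain ⟨u, rfl, rfl⟩ := (LinearPMap.mem_graph_iff H).mp h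
  rw [← inner_conj_symm]
  exact hH.2 u

/-- `x ↦ x + H x`, defined on the graph of `H`. -/
def graphAdd (H : E →ₗ.[ℂ] E) : H.graph →L[ℂ] E :=
  (ContinuousLinearMap.fst ℂ E E + ContinuousLinearMap.snd ℂ E E) ∘L H.graph.subtypeL

/-- Positivity makes the cross term of `‖x + H x‖²` nonnegative. -/
theorem norm_le_norm_graphAdd {H : E →ₗ.[ℂ] E} (hH : IsPositiveSelfadjoint H) (p : H.graph) :
    ‖p‖ ≤ ‖graphAdd H p‖ := by
  obtain ⟨⟨x, y⟩, hp⟩ := p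
  have h1 := re_inner_nonneg_of_mem_graph hH hp
  have h2 : ‖x + y‖ ^ 2 = ‖x‖ ^ 2 + 2 * (inner ℂ x y).re + ‖y‖ ^ 2 :=
    norm_add_sq (𝕜 := ℂ) x y
  change max ‖x‖ ‖y‖ ≤ ‖x + y‖
  refine max_le ?_ ?_ <;> refine le_of_sq_le_sq ?_ (norm_nonneg _) <;>
    nlinarith [sq_nonneg ‖x‖, sq_nonneg ‖y‖]

/-- The lower bound gives injectivity and, the graph being complete, closed range; it remains to see
that nothing is orthogonal to the range. -/
theorem graphAdd_bijective {H : E →ₗ.[ℂ] E} (hH : IsPositiveSelfadjoint H) :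
    Function.Bijective (graphAdd H) := by
  have hanti : AntilipschitzWith 1 (graphAdd H) :=
    ContinuousLinearMap.antilipschitz_of_bound _ fun p => by
      simpa using norm_le_norm_graphAdd hH p
  refine ⟨hanti.injective, ?_⟩
  have : CompleteSpace H.graph := IsClosed.completeSpace_coe (hs := hH.1.isClosed)
  have hcl : IsClosed (Set.range (graphAdd H)) :=
    hanti.isClosed_range (graphAdd H).uniformContinuous
  have : (graphAdd H).range = ⊤ := by
    have : CompleteSpace (graphAdd H).range := hcl.completeSpace_coe
    rw [← Submodule.orthogonal_eq_bot_iff, Submodule.eq_bot_iff]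
    intro w hw
    -- A vector orthogonal to the range of `1 + H` satisfies `H w = -w`, which positivity forbids
    -- unless `w = 0`.
    have hg : (w, -w) ∈ H.graph := by
      rw [mem_graph_iff_of_isSelfAdjoint hH.1]
      intro a b hab
      have := hw (a + b) ⟨⟨(a, b), hab⟩, rfl⟩
      rw [inner_add_left] at this
      rw [inner_neg_right, eq_neg_iff_add_eq_zero, add_comm, this]
    have h := re_inner_nonneg_of_mem_graph hH hg
    rw [inner_neg_right, Complex.neg_re] at h
    have h' : (inner ℂ w w).re = ‖w‖ ^ 2 := inner_self_eq_norm_sq (𝕜 := ℂ) w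
    rw [← norm_eq_zero]
    nlinarith [sq_nonneg ‖w‖]
  exact LinearMap.range_eq_top.mp this

/-- A positive selfadjoint operator has a bounded resolvent `A = (1 + H)⁻¹`, through which its
graph is parametrized. -/
theorem exists_graph_eq_range {H : E →ₗ.[ℂ] E} (hH : IsPositiveSelfadjoint H) :
    ∃ A : E →L[ℂ] E, 0 ≤ A ∧ 0 ≤ 1 - A ∧
      ∀ x y, (x, y) ∈ H.graph ↔ ∃ t, A t = x ∧ (1 - A) t = y := by
  have : CompleteSpace H.graph := IsClosed.completeSpace_coe (hs := hH.1.isClosed)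
  let e : H.graph ≃L[ℂ] E := ContinuousLinearEquiv.ofBijective (graphAdd H)
    (LinearMap.ker_eq_bot.mpr (graphAdd_bijective hH).1)
    (LinearMap.range_eq_top.mpr (graphAdd_bijective hH).2)
  let A : E →L[ℂ] E := ContinuousLinearMap.fst ℂ E E ∘L H.graph.subtypeL ∘L
    (e.symm : E →L[ℂ] H.graph)
  have hsum : ∀ t, (e.symm t : E × E).1 + (e.symm t : E × E).2 = t := fun t =>
    e.apply_symm_apply t
  have hA : ∀ t, A t = (e.symm t : E × E).1 := fun t => rfl
  have hA' : ∀ t, (1 - A) t = (e.symm t : E × E).2 := fun t => by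
    rw [_root_.sub_apply, hA]
    exact sub_eq_of_eq_add' (hsum t).symm
  have hmem : ∀ t, (A t, (1 - A) t) ∈ H.graph := fun t => by
    rw [hA, hA']; exact (e.symm t).2
  have hadd : ∀ t, A t + (1 - A) t = t := fun t => by simp
  have hpos : ∀ t, 0 ≤ (inner ℂ (A t) ((1 - A) t)).re := fun t =>
    re_inner_nonneg_of_mem_graph hH (hmem t)
  have hself : ∀ t : E, 0 ≤ (inner ℂ t t).re := fun t => inner_self_nonneg (𝕜 := ℂ)
  have hsymm : ∀ s t, inner ℂ (A s) t = inner ℂ s (A t) := fun s t => by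
    have := inner_eq_of_isSelfAdjoint hH.1 (hmem t) (hmem s)
    conv_lhs => rw [← hadd t]
    conv_rhs => rw [← hadd s]
    rw [inner_add_right, inner_add_left, this]
  refine ⟨A, ?_, ?_, fun x y => ⟨fun h => ?_, ?_⟩⟩
  · rw [ContinuousLinearMap.nonneg_iff_isPositive]
    refine ⟨hsymm, fun t => ?_⟩
    change 0 ≤ (inner ℂ (A t) t).re
    have : inner ℂ (A t) t = inner ℂ (A t) (A t) + inner ℂ (A t) ((1 - A) t) := by
      rw [← inner_add_right, hadd]
    rw [this, Complex.add_re]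
    exact add_nonneg (hself _) (hpos t)
  · rw [ContinuousLinearMap.nonneg_iff_isPositive]
    refine ⟨fun s t => ?_, fun t => ?_⟩
    · change inner ℂ (s - A s) t = inner ℂ s (t - A t)
      rw [inner_sub_left, inner_sub_right, hsymm]
    · change 0 ≤ (inner ℂ ((1 - A) t) t).re
      have : inner ℂ ((1 - A) t) t
          = inner ℂ ((1 - A) t) (A t) + inner ℂ ((1 - A) t) ((1 - A) t) := by
        rw [← inner_add_right, hadd]
      rw [this, Complex.add_re, ← inner_conj_symm]
      exact add_nonneg (hpos t) (hself _)
  · refine ⟨x + y, ?_⟩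
    have : e.symm (x + y) = ⟨(x, y), h⟩ := by
      rw [ContinuousLinearEquiv.symm_apply_eq]; rfl
    rw [hA, hA', this]
    exact ⟨rfl, rfl⟩
  · rintro ⟨t, rfl, rfl⟩
    exact hmem t

/-- Every positive selfadjoint operator has a positive square root. -/
theorem exists_isPositiveSqrt {H : E →ₗ.[ℂ] E} (hH : IsPositiveSelfadjoint H) :
    ∃ S, IsPositiveSqrt H S := by
  obtain ⟨A, hA, hA', hgraph⟩ := exists_graph_eq_range hH
  set B := CFC.sqrt A with hB
  set C := CFC.sqrt (1 - A) with hC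
  have hBB : ∀ t, B (B t) = A t := fun t =>
    congrArg (fun f : E →L[ℂ] E => f t) (CFC.sqrt_mul_sqrt_self A)
  have hCC : ∀ t, C (C t) = (1 - A) t := fun t =>
    congrArg (fun f : E →L[ℂ] E => f t) (CFC.sqrt_mul_sqrt_self (1 - A))
  have hB0 : 0 ≤ B := CFC.sqrt_nonneg _
  have hC0 : 0 ≤ C := CFC.sqrt_nonneg _
  have hcomm : Commute B C := by
    have h1 : Commute A (1 - A) := (Commute.one_right A).sub_right (Commute.refl A)
    have h2 : Commute B (1 - A) := Commute.cfcₙ_nnreal h1 _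
    exact (Commute.cfcₙ_nnreal h2.symm _).symm
  have hBC : ∀ t, B (C t) = C (B t) := fun t =>
    congrArg (fun f : E →L[ℂ] E => f t) hcomm.eq
  have hsum : ∀ t, B (B t) + C (C t) = t := fun t => by rw [hBB, hCC]; simp
  have hBs : ∀ s t, inner ℂ (B s) t = inner ℂ s (B t) :=
    ((ContinuousLinearMap.nonneg_iff_isPositive _).mp hB0).isSymmetric
  have hCs : ∀ s t, inner ℂ (C s) t = inner ℂ s (C t) :=
    ((ContinuousLinearMap.nonneg_iff_isPositive _).mp hC0).isSymmetric
  have hiff : ∀ u v, C u = B v ↔ ∃ t, B t = u ∧ C t = v := fun u v => by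
    constructor
    · intro h
      -- From `u = B t`, `v = C t` and `B² + C² = 1` one must have `t = B u + C v`.
      refine ⟨B u + C v, ?_, ?_⟩
      · rw [map_add, hBC, ← h, hsum]
      · rw [map_add, ← hBC, h, hsum]
    · rintro ⟨t, rfl, rfl⟩
      exact (hBC t).symm
  -- If `A t = 0`, then `(0, t)` lies in the graph of `H`, which is single-valued.
  have hAinj : ∀ t, A t = 0 → t = 0 := fun t ht => by
    have h1 : ((0 : E), (1 - A) t) ∈ H.graph := (hgraph _ _).mpr ⟨t, ht, rfl⟩
    have h2 := H.graph_fst_eq_zero_snd h1 rfl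
    simpa [ht] using h2
  have hBinj : ∀ t, B t = 0 → t = 0 := fun t ht => hAinj t (by rw [← hBB, ht, map_zero])
  let G : Submodule ℂ (E × E) := LinearMap.range (B.toLinearMap.prod C.toLinearMap)
  have hG : ∀ x y, (x, y) ∈ G ↔ ∃ t, B t = x ∧ C t = y := fun x y => by
    simp [G, LinearMap.mem_range, Prod.ext_iff]
  let S : E →ₗ.[ℂ] E := G.toLinearPMap
  have hS : S.graph = G := Submodule.toLinearPMap_graph_eq _ (by
    rintro ⟨x, y⟩ hxy hx
    obtain ⟨t, h1, h2⟩ := (hG x y).mp hxy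
    have : t = 0 := hBinj t (h1.trans hx)
    rw [← h2, this, map_zero])
  have hSg : ∀ x y, (x, y) ∈ S.graph ↔ ∃ t, B t = x ∧ C t = y := fun x y => by rw [hS, hG]
  have hdense : Dense (S.domain : Set E) := by
    rw [Submodule.dense_iff_topologicalClosure_eq_top,
      Submodule.topologicalClosure_eq_top_iff, Submodule.eq_bot_iff]
    intro w hw
    refine hBinj w ?_
    refine ext_inner_left ℂ fun t => ?_
    rw [← hBs, inner_zero_right]
    exact hw _ (LinearPMap.mem_domain_of_mem_graph ((hSg _ _).mpr ⟨t, rfl, rfl⟩))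
  refine ⟨S, ⟨isSelfAdjoint_of_mem_graph_iff hdense fun x y => ?_, fun x => ?_⟩, ?_⟩
  -- Pairing with all `(B t, C t)` amounts to `C x = B y`, which by `hiff` is membership in the
  -- graph.
  · rw [hSg, ← hiff]
    constructor
    · rintro h a b hab
      obtain ⟨t, rfl, rfl⟩ := (hSg a b).mp hab
      rw [hCs, hBs, h]
    · intro h
      refine ext_inner_left ℂ fun t => ?_
      rw [← hCs, ← hBs]
      exact h _ _ ((hSg _ _).mpr ⟨t, rfl, rfl⟩)
  · obtain ⟨t, h1, h2⟩ := (hSg _ _).mp (S.mem_graph x)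
    rw [← h1, ← h2]
    -- For `x = B t` the form `⟨S x, x⟩` is `⟨B C t, t⟩`, and a product of commuting positive
    -- operators is positive.
    have : 0 ≤ B * C := Commute.mul_nonneg hB0 hC0 hcomm
    have h3 := ((ContinuousLinearMap.nonneg_iff_isPositive _).mp this).re_inner_nonneg_left t
    rw [← hBs]
    exact h3
  · apply LinearPMap.eq_of_eq_graph
    ext ⟨x, z⟩
    rw [mem_graph_pcomp_iff, hgraph]
    constructor
    · rintro ⟨y, h1, h2⟩
      obtain ⟨s, rfl, rfl⟩ := (hSg _ _).mp h1
      obtain ⟨r, h3, rfl⟩ := (hSg _ _).mp h2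
      obtain ⟨t, rfl, rfl⟩ := (hiff s r).mp h3.symm
      exact ⟨t, (hBB t).symm, (hCC t).symm⟩
    · rintro ⟨t, rfl, rfl⟩
      exact ⟨C (B t), (hSg _ _).mpr ⟨B t, hBB t, rfl⟩, (hSg _ _).mpr ⟨C t, hBC t, hCC t⟩⟩

theorem isPositiveSqrt_sqrt {H : E →ₗ.[ℂ] E} (hH : IsPositiveSelfadjoint H) :
    IsPositiveSqrt H (sqrt H) :=
  Classical.epsilon_spec (exists_isPositiveSqrt hH)

end Sqrt

/-! ### The Hamiltonian of a closed embedding and its comparison with the square root. -/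

section Hamiltonian

variable {E F : Type*} [NormedAddCommGroup E] [InnerProductSpace ℂ E]
  [NormedAddCommGroup F] [InnerProductSpace ℂ F]

theorem ker_toFun_eq_bot_of_injective {f : E →ₗ.[ℂ] F} (hf : Function.Injective f) :
    LinearMap.ker f.toFun = ⊥ :=
  LinearMap.ker_eq_bot.mpr hf

theorem mem_graph_inverse_iff {f : E →ₗ.[ℂ] F} (hf : LinearMap.ker f.toFun = ⊥) {x : E} {y : F} :
    (y, x) ∈ f.inverse.graph ↔ (x, y) ∈ f.graph := by
  rw [LinearPMap.inverse_graph hf]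
  constructor
  · rintro ⟨⟨a, b⟩, h, hab⟩
    cases hab
    exact h
  · exact fun h => ⟨(x, y), h, rfl⟩

theorem eq_of_mem_graph_of_injective {f : E →ₗ.[ℂ] F} (hf : Function.Injective f) {x x' : E}
    {y : F} (h : (x, y) ∈ f.graph) (h' : (x', y) ∈ f.graph) : x = x' := by
  obtain ⟨u, rfl, hu⟩ := (LinearPMap.mem_graph_iff f).mp h
  obtain ⟨v, rfl, hv⟩ := (LinearPMap.mem_graph_iff f).mp h'
  rw [hf (hu.trans hv.symm)]

theorem eq_zero_of_forall_mem_graph_inner {f : E →ₗ.[ℂ] F} (hr : Dense (Set.range f)) {z : F}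
    (h : ∀ a b, (a, b) ∈ f.graph → inner ℂ b z = 0) : z = 0 := by
  refine hr.eq_zero_of_inner_right ℂ ?_
  rintro _ ⟨a, rfl⟩
  exact h _ _ (f.mem_graph a)

theorem isClosed_graph_inverse {j : E →ₗ.[ℂ] F} (hj : IsCloseEmbedding j) :
    IsClosed (j.inverse.graph : Set (F × E)) :=
  (LinearPMap.inverse_closed_iff (ker_toFun_eq_bot_of_injective hj.injective)).mpr hj.closed

/-- For a dense linear manifold `D`, the norm of `y` is the supremum of `|⟨d, y⟩| / ‖d‖`. -/
theorem isLUB_nnnorm_inner_div {D : Submodule ℂ F} (hD : Dense (D : Set F)) (y : F) :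
    IsLUB {r : ℝ≥0 | ∃ d ∈ D, d ≠ 0 ∧ r = ‖inner ℂ d y‖₊ / ‖d‖₊} ‖y‖₊ := by
  constructor
  · rintro _ ⟨d, -, hd, rfl⟩
    rw [div_le_iff₀ (nnnorm_pos.mpr hd), mul_comm]
    exact nnnorm_inner_le_nnnorm d y
  · intro b hb
    have h : ∀ d : F, ‖inner ℂ d y‖₊ ≤ b * ‖d‖₊ := by
      intro d
      refine hD.induction (P := fun d => ‖inner ℂ d y‖₊ ≤ b * ‖d‖₊) (fun d hd => ?_)
        (isClosed_le (by fun_prop) (by fun_prop)) d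
      rcases eq_or_ne d 0 with rfl | h0
      · simp
      · rw [← div_le_iff₀ (nnnorm_pos.mpr h0)]
        exact hb ⟨d, hd, h0, rfl⟩
    rcases eq_or_ne y 0 with rfl | h0
    · simp
    -- The bound extends from `D` to all of `F` by density; testing it at `d = y` gives `‖y‖² ≤ b
    -- ‖y‖`.
    · refine le_of_mul_le_mul_right ?_ (nnnorm_pos.mpr h0)
      refine le_trans (le_of_eq ?_) (h y)
      rw [← NNReal.coe_inj, coe_nnnorm, inner_self_eq_norm_sq_to_K]
      simp [sq]

variable [CompleteSpace E] {j : E →ₗ.[ℂ] F}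

/-- Both factors are one-to-one: `j` by assumption, and `j^*` because its kernel is orthogonal to
the dense range of `j`. This makes the inverse in `hamiltonian` meaningful. -/
theorem ker_kernelOperator_eq_bot (hj : IsCloseEmbedding j) (hr : Dense (Set.range j)) :
    LinearMap.ker (kernelOperator j).toFun = ⊥ := by
  rw [LinearMap.ker_eq_bot']
  intro z hz
  have h : ((z : F), (0 : F)) ∈ (kernelOperator j).graph := by
    rw [← hz]; exact LinearPMap.mem_graph _ z
  obtain ⟨k, h1, h2⟩ := mem_graph_pcomp_iff.mp h
  have hk : k = 0 := eq_of_mem_graph_of_injective hj.injective h2 j.graph.zero_mem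
  rw [mem_graph_adjoint_iff hj.dense_domain] at h1
  refine Subtype.ext (eq_zero_of_forall_mem_graph_inner hr fun a b hab => ?_)
  rw [h1 a b hab, hk, inner_zero_right]

theorem mem_graph_hamiltonian_iff (hj : IsCloseEmbedding j) (hr : Dense (Set.range j)) {x z : F} :
    (x, z) ∈ (hamiltonian j).graph ↔ ∃ u, (u, x) ∈ j.graph ∧ (z, u) ∈ j.adjoint.graph := by
  rw [hamiltonian, mem_graph_inverse_iff (ker_kernelOperator_eq_bot hj hr), kernelOperator,
    mem_graph_pcomp_iff]
  exact exists_congr fun _ => and_comm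

/-- The bridge to the core argument: `(j j^*)⁻¹ = T^* T` for `T = j⁻¹`, since `u = j^* z` says
exactly that `z = T^* u`. -/
theorem adjCompSelf_inverse_iff (hj : IsCloseEmbedding j) (hr : Dense (Set.range j)) {x z : F} :
    AdjCompSelf j.inverse.graph x z ↔ (x, z) ∈ (hamiltonian j).graph := by
  have hk := ker_toFun_eq_bot_of_injective hj.injective
  rw [mem_graph_hamiltonian_iff hj hr]
  refine exists_congr fun u => ?_
  rw [mem_graph_inverse_iff hk, mem_graph_adjoint_iff hj.dense_domain]
  refine and_congr_right fun _ => ⟨fun h a b hab => ?_, fun h a b hab => ?_⟩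
  · exact (h b a ((mem_graph_inverse_iff hk).mpr hab)).symm
  · exact (h b a ((mem_graph_inverse_iff hk).mp hab)).symm

theorem adjCompSelf_iff_of_isPositiveSqrt {H S : E →ₗ.[ℂ] E} (hS : IsPositiveSqrt H S) {x z : E} :
    AdjCompSelf S.graph x z ↔ (x, z) ∈ H.graph := by
  rw [← hS.2, mem_graph_pcomp_iff]
  refine exists_congr fun k => and_congr_right fun _ => ?_
  rw [mem_graph_iff_of_isSelfAdjoint hS.1.1]

/-- If `z = H y` then `v = j^* z`, so `⟨j u, z⟩ = ⟨u, j^* z⟩ = ⟨u, v⟩`. -/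
theorem inner_hamiltonian_eq {H : F →ₗ.[ℂ] F} (hj : IsCloseEmbedding j) (hr : Dense (Set.range j))
    (hH : hamiltonian j = H) {u v : E} {x y z : F} (hu : (u, x) ∈ j.graph)
    (hv : (v, y) ∈ j.graph) (hz : (y, z) ∈ H.graph) : inner ℂ x z = inner ℂ u v := by
  rw [← hH] at hz
  obtain ⟨k, hk, hzk⟩ := (mem_graph_hamiltonian_iff hj hr).mp hz
  rw [eq_of_mem_graph_of_injective hj.injective hv hk]
  exact (mem_graph_adjoint_iff hj.dense_domain).mp hzk u x hu

/-- Two densely defined one-to-one operators with the same range, at each point of which the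
preimages have the same norm, are related by a unitary operator. -/
theorem exists_linearIsometryEquiv_of_range_eq {E' : Type*} [NormedAddCommGroup E']
    [InnerProductSpace ℂ E'] [CompleteSpace E'] {i : E' →ₗ.[ℂ] F}
    (hi : Function.Injective i) (hj : Function.Injective j)
    (hid : Dense (i.domain : Set E')) (hjd : Dense (j.domain : Set E))
    (hrange : Set.range i = Set.range j)
    (hnorm : ∀ u v x, (u, x) ∈ i.graph → (v, x) ∈ j.graph → ‖v‖ = ‖u‖) :
    ∃ Φ : E' ≃ₗᵢ[ℂ] E, ∀ u v x, (u, x) ∈ i.graph → (v, x) ∈ j.graph → Φ u = v := by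
  have hr : LinearMap.range i.toFun = LinearMap.range j.toFun := SetLike.coe_injective hrange
  let f : i.domain ≃ₗ[ℂ] j.domain := (LinearEquiv.ofInjective i.toFun hi).trans
    ((LinearEquiv.ofEq _ _ hr).trans (LinearEquiv.ofInjective j.toFun hj).symm)
  have hf : ∀ u, j (f u) = i u := fun u => by
    have := (LinearEquiv.ofInjective j.toFun hj).apply_symm_apply
      (LinearEquiv.ofEq _ _ hr (LinearEquiv.ofInjective i.toFun hi u))
    exact congrArg Subtype.val this
  have hfg : ∀ u, ((f u : E), i u) ∈ j.graph := fun u => by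
    rw [← hf]; exact j.mem_graph _
  let Φ := f.extendOfIsometry i.domain.subtype j.domain.subtype hid.denseRange_val
    hjd.denseRange_val fun u => hnorm _ _ _ (i.mem_graph u) (hfg u)
  refine ⟨Φ, fun u v x hu hv => ?_⟩
  obtain ⟨u, rfl, rfl⟩ := (LinearPMap.mem_graph_iff i).mp hu
  refine (LinearEquiv.extendOfIsometry_eq f i.domain.subtype j.domain.subtype _ _ _ u).trans ?_
  exact eq_of_mem_graph_of_injective hj (hfg u) hv

variable [CompleteSpace F] {H S : F →ₗ.[ℂ] F}

theorem exists_mem_graph_of_mem_graph_sqrt (hj : IsCloseEmbedding j) (hr : Dense (Set.range j))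
    (hH : hamiltonian j = H) (hS : IsPositiveSqrt H S) {x k : F} (h : (x, k) ∈ S.graph) :
    ∃ u, (u, x) ∈ j.graph ∧ ‖u‖ = ‖k‖ := by
  obtain ⟨u, hu, hn⟩ := exists_norm_eq_of_adjCompSelf_imp S.graph j.inverse.graph
    hS.1.1.isClosed (isClosed_graph_inverse hj)
    (fun k hk => S.graph_fst_eq_zero_snd hk rfl)
    (fun x z hxz => by
      rwa [adjCompSelf_inverse_iff hj hr, hH, ← adjCompSelf_iff_of_isPositiveSqrt hS]) h
  exact ⟨u, (mem_graph_inverse_iff (ker_toFun_eq_bot_of_injective hj.injective)).mp hu, hn⟩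

theorem exists_mem_graph_sqrt_of_mem_graph (hj : IsCloseEmbedding j) (hr : Dense (Set.range j))
    (hH : hamiltonian j = H) (hS : IsPositiveSqrt H S) {u : E} {x : F} (h : (u, x) ∈ j.graph) :
    ∃ k, (x, k) ∈ S.graph ∧ ‖k‖ = ‖u‖ :=
  exists_norm_eq_of_adjCompSelf_imp j.inverse.graph S.graph
    (isClosed_graph_inverse hj) hS.1.1.isClosed
    (fun k hk => j.inverse.graph_fst_eq_zero_snd hk rfl)
    (fun x z hxz => by
      rwa [adjCompSelf_inverse_iff hj hr, hH, ← adjCompSelf_iff_of_isPositiveSqrt hS] at hxz)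
    ((mem_graph_inverse_iff (ker_toFun_eq_bot_of_injective hj.injective)).mpr h)

theorem range_eq_domain_sqrt (hj : IsCloseEmbedding j) (hr : Dense (Set.range j))
    (hH : hamiltonian j = H) (hS : IsPositiveSqrt H S) : Set.range j = S.domain := by
  ext x
  rw [LinearPMap.mem_range_iff, SetLike.mem_coe, LinearPMap.mem_domain_iff]
  constructor
  · rintro ⟨u, hu⟩
    obtain ⟨k, hk, -⟩ := exists_mem_graph_sqrt_of_mem_graph hj hr hH hS hu
    exact ⟨k, hk⟩
  · rintro ⟨k, hk⟩
    obtain ⟨u, hu, -⟩ := exists_mem_graph_of_mem_graph_sqrt hj hr hH hS hk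
    exact ⟨u, hu⟩

theorem norm_eq_norm_sqrt (hj : IsCloseEmbedding j) (hr : Dense (Set.range j))
    (hH : hamiltonian j = H) (hS : IsPositiveSqrt H S) {u : E} {x k : F}
    (hu : (u, x) ∈ j.graph) (hk : (x, k) ∈ S.graph) : ‖u‖ = ‖k‖ := by
  obtain ⟨k', hk', hn⟩ := exists_mem_graph_sqrt_of_mem_graph hj hr hH hS hu
  rw [← hn, S.mem_graph_snd_inj hk hk' rfl]

theorem isDenseVia_domain_sqrt (hj : IsCloseEmbedding j) (hr : Dense (Set.range j))
    (hH : hamiltonian j = H) (hS : IsPositiveSqrt H S) : IsDenseVia j S.domain := by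
  have h := range_eq_domain_sqrt hj hr hH hS
  refine ⟨h.ge, hj.dense_domain.mono fun u hu => ⟨hu, ?_⟩⟩
  exact h.le ⟨⟨u, hu⟩, rfl⟩

theorem isDenseVia_domain_hamiltonian (hj : IsCloseEmbedding j) (hr : Dense (Set.range j))
    (hH : hamiltonian j = H) : IsDenseVia j H.domain := by
  have hk := ker_toFun_eq_bot_of_injective hj.injective
  subst hH
  constructor
  · intro x hx
    obtain ⟨z, hz⟩ := LinearPMap.mem_domain_iff.mp hx
    obtain ⟨u, hu, -⟩ := (mem_graph_hamiltonian_iff hj hr).mp hz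
    exact LinearPMap.mem_range_iff.mpr ⟨u, hu⟩
  · refine Dense.of_closure (hj.dense_domain.mono fun u hu => ?_)
    have hc := mem_closure_adjCore j.inverse.graph (isClosed_graph_inverse hj)
      (fun k hk => j.inverse.graph_fst_eq_zero_snd hk rfl)
      ((mem_graph_inverse_iff hk).mpr (j.mem_graph ⟨u, hu⟩))
    -- The second coordinate of the graph of `j⁻¹` lives in `E`, so projecting the core statement
    -- gives density in `E`.
    refine closure_mono ?_ (image_closure_subset_closure_image continuous_snd ⟨_, hc, rfl⟩)
    rintro _ ⟨⟨x, v⟩, ⟨hxv, z, hz⟩, rfl⟩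
    have hxz := (adjCompSelf_inverse_iff hj hr).mp ⟨v, hxv, hz⟩
    obtain ⟨w, rfl, rfl⟩ := (LinearPMap.mem_graph_iff _).mp ((mem_graph_inverse_iff hk).mp hxv)
    exact ⟨w.2, LinearPMap.mem_domain_of_mem_graph hxz⟩

/-- Since `⟨j x, S z⟩ = ⟨S (j x), z⟩` and `Dom S` is dense, the supremum is `‖S (j x)‖ = ‖x‖`. -/
theorem isLUB_inner_sqrt (hj : IsCloseEmbedding j) (hr : Dense (Set.range j))
    (hH : hamiltonian j = H) (hS : IsPositiveSqrt H S) (x : j.domain) :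
    IsLUB {r : ℝ≥0 | ∃ z : S.domain, (z : F) ≠ 0 ∧
      r = ‖inner ℂ (j x) (S z)‖₊ / ‖(z : F)‖₊} ‖(x : E)‖₊ := by
  obtain ⟨k, hk, hn⟩ := exists_mem_graph_sqrt_of_mem_graph hj hr hH hS (j.mem_graph x)
  have hn' : ‖k‖₊ = ‖(x : E)‖₊ := NNReal.coe_injective hn
  rw [← hn']
  convert isLUB_nnnorm_inner_div hS.1.1.dense_domain k using 1
  have key : ∀ z : S.domain, ‖inner ℂ (j x) (S z)‖₊ = ‖inner ℂ (z : F) k‖₊ := fun z => by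
    rw [← inner_eq_of_isSelfAdjoint hS.1.1 hk (S.mem_graph z)]
    exact NNReal.coe_injective (norm_inner_symm _ _)
  ext r
  constructor
  · rintro ⟨z, hz, rfl⟩
    exact ⟨z, z.2, hz, by rw [key]⟩
  · rintro ⟨z, hz, h0, rfl⟩
    exact ⟨⟨z, hz⟩, h0, by rw [key]⟩

end Hamiltonian

/-! ### Operators on a completion, seen through an isometry into a Hilbert space. -/

section Completion

variable {E F F' : Type*} [NormedAddCommGroup E] [InnerProductSpace ℂ E]
  [NormedAddCommGroup F] [InnerProductSpace ℂ F]
  [NormedAddCommGroup F'] [InnerProductSpace ℂ F'] [CompleteSpace F']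

theorem mem_graph_onCompletion_iff {ι : E →ₗ[ℂ] F} {w : Completion E} {y : F} :
    (w, y) ∈ (onCompletion ι).graph ↔ ∃ v : E, (v : Completion E) = w ∧ ι v = y := by
  have h : ∀ v : E, ∀ hv : (v : Completion E) ∈ (onCompletion ι).domain,
      onCompletion ι ⟨v, hv⟩ = ι v := fun v hv =>
    congrArg ι ((LinearEquiv.ofInjective (Completion.toComplₗᵢ (𝕜 := ℂ) (E := E)).toLinearMap
      (Completion.toComplₗᵢ (𝕜 := ℂ) (E := E)).injective).symm_apply_apply v)
  rw [LinearPMap.mem_graph_iff]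
  constructor
  · rintro ⟨⟨_, v, rfl⟩, rfl, rfl⟩
    exact ⟨v, rfl, (h v _).symm⟩
  · rintro ⟨v, rfl, rfl⟩
    exact ⟨⟨v, v, rfl⟩, rfl, h v _⟩

theorem dense_domain_onCompletion (ι : E →ₗ[ℂ] F) :
    Dense ((onCompletion ι).domain : Set (Completion E)) :=
  Completion.denseRange_coe

theorem range_onCompletion (ι : E →ₗ[ℂ] F) : Set.range (onCompletion ι) = Set.range ι := by
  ext y
  rw [LinearPMap.mem_range_iff]
  simp only [mem_graph_onCompletion_iff]
  exact ⟨fun ⟨_, v, _, h⟩ => ⟨v, h⟩, fun ⟨v, h⟩ => ⟨v, v, rfl, h⟩⟩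

theorem injective_onCompletion {ι : E →ₗ[ℂ] F} (hι : Function.Injective ι) :
    Function.Injective (onCompletion ι) :=
  hι.comp (LinearEquiv.injective _)

/-- The extension of a linear isometry to the completion. -/
def completionExtend (κ : E →ₗᵢ[ℂ] F') : Completion E →ₗᵢ[ℂ] F' where
  toLinearMap := (κ.toContinuousLinearMap.extend
    (Completion.toComplₗᵢ (𝕜 := ℂ) (E := E)).toContinuousLinearMap).toLinearMap
  norm_map' w := by
    refine Completion.induction_on w (isClosed_eq ?_ continuous_norm) fun v => ?_
    · exact (ContinuousLinearMap.continuous _).norm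
    · refine (congrArg norm (ContinuousLinearMap.extend_eq κ.toContinuousLinearMap
        (e := (Completion.toComplₗᵢ (𝕜 := ℂ) (E := E)).toContinuousLinearMap)
        Completion.denseRange_coe (Completion.isUniformInducing_coe E) v)).trans ?_
      rw [Completion.norm_coe]
      exact κ.norm_map v

theorem completionExtend_coe (κ : E →ₗᵢ[ℂ] F') (v : E) :
    completionExtend κ (v : Completion E) = κ v :=
  ContinuousLinearMap.extend_eq κ.toContinuousLinearMap
    (e := (Completion.toComplₗᵢ (𝕜 := ℂ) (E := E)).toContinuousLinearMap)
    Completion.denseRange_coe (Completion.isUniformInducing_coe E) v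

/-- The extension of `κ` is injective, so the graph is the preimage of the closed set `C` under a
continuous map. -/
theorem isClosed_onCompletion (ι : E →ₗ[ℂ] F) (κ : E →ₗᵢ[ℂ] F') {C : Set (F × F')}
    (hC : IsClosed C) (hCι : ∀ y k, (y, k) ∈ C ↔ ∃ v, ι v = y ∧ κ v = k) :
    (onCompletion ι).IsClosed := by
  have : ((onCompletion ι).graph : Set (Completion E × F)) =
      (fun p : Completion E × F => (p.2, completionExtend κ p.1)) ⁻¹' C := by
    ext ⟨w, y⟩
    rw [SetLike.mem_coe, mem_graph_onCompletion_iff, Set.mem_preimage, hCι]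
    refine exists_congr fun v => ?_
    rw [and_comm, ← completionExtend_coe, (completionExtend κ).injective.eq_iff]
  rw [LinearPMap.IsClosed, this]
  exact hC.preimage (continuous_snd.prodMk
    ((completionExtend κ).continuous.comp continuous_fst))

theorem mem_graph_adjoint_onCompletion_iff (ι : E →ₗ[ℂ] F) (κ : E →ₗᵢ[ℂ] F') {z : F}
    {w : Completion E} : (z, w) ∈ (onCompletion ι).adjoint.graph ↔
      ∀ v, inner ℂ (κ v) (completionExtend κ w) = inner ℂ (ι v) z := by
  rw [mem_graph_adjoint_iff (dense_domain_onCompletion ι)]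
  have h : ∀ v : E, inner ℂ (κ v) (completionExtend κ w) = inner ℂ (v : Completion E) w :=
    fun v => by rw [← completionExtend_coe, LinearIsometry.inner_map_map]
  constructor
  · intro hz v
    rw [h, hz _ _ (mem_graph_onCompletion_iff.mpr ⟨v, rfl, rfl⟩)]
  · intro hz a b hab
    obtain ⟨v, rfl, rfl⟩ := mem_graph_onCompletion_iff.mp hab
    rw [← hz, h]

end Completion

/-! ### The graph of `T` parametrized by the pre-Hilbert spaces behind `𝒟(T)` and `ℛ(T)`. -/

section Spaces

variable {E : Type*} [NormedAddCommGroup E] [InnerProductSpace ℂ E]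

/-- `T` as a linear isometry on `Dom T ⊖ ker T` with the norm `|x|_T`. -/
def DPre.mapₗᵢ (T : E →ₗ.[ℂ] E) : DPre T →ₗᵢ[ℂ] E :=
  (DPre.map T).isometryOfInner fun _ _ => rfl

/-- The inverse of `T` as a linear isometry on `Ran T` with the norm `‖·‖_T`. -/
def RPre.preimageₗᵢ (T : E →ₗ.[ℂ] E) : RPre T →ₗᵢ[ℂ] E :=
  (RPre.preimage T).isometryOfInner fun _ _ => rfl

theorem nullSpace_eq_bot {T : E →ₗ.[ℂ] E} (hT : ZeroNotEigenvalue T) : nullSpace T = ⊥ := by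
  rw [Submodule.eq_bot_iff]
  rintro _ ⟨x, hx, rfl⟩
  exact hT x hx

theorem mem_graph_iff_exists_DPre {T : E →ₗ.[ℂ] E} (hT : ZeroNotEigenvalue T) {x k : E} :
    (x, k) ∈ T.graph ↔ ∃ v, DPre.incl T v = x ∧ DPre.mapₗᵢ T v = k := by
  constructor
  · intro h
    obtain ⟨u, rfl, rfl⟩ := (LinearPMap.mem_graph_iff T).mp h
    have hu : (u : E) ∈ coDomain T := ⟨u.2, by rw [nullSpace_eq_bot hT]; simp⟩
    exact ⟨⟨u, hu⟩, rfl, rfl⟩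
  · rintro ⟨v, rfl, rfl⟩
    exact T.mem_graph ⟨v.1, v.2.1⟩

theorem mem_graph_iff_exists_RPre {T : E →ₗ.[ℂ] E} (hT : ZeroNotEigenvalue T) {x k : E} :
    (x, k) ∈ T.graph ↔ ∃ v, RPre.incl T v = k ∧ RPre.preimageₗᵢ T v = x := by
  let e := LinearEquiv.ofInjective (coRestrict T) (coRestrict_injective T)
  rw [mem_graph_iff_exists_DPre hT]
  constructor
  · rintro ⟨v, rfl, rfl⟩
    exact ⟨e v, rfl, congrArg Subtype.val (e.symm_apply_apply v)⟩
  · rintro ⟨v, rfl, rfl⟩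
    exact ⟨e.symm v, rfl, congrArg Subtype.val (e.apply_symm_apply v)⟩

end Spaces

/-! ### The model triplet built from a selfadjoint operator with trivial kernel. -/

section SqrtTriplet

variable {E : Type*} [NormedAddCommGroup E] [InnerProductSpace ℂ E]

theorem injective_iEmb (S : E →ₗ.[ℂ] E) : Function.Injective (iEmb S) :=
  injective_onCompletion (coDomain S).subtype_injective

theorem injective_jEmb (S : E →ₗ.[ℂ] E) : Function.Injective (jEmb S) :=
  injective_onCompletion (LinearMap.range (coRestrict S)).subtype_injective

theorem ker_jEmb_eq_bot (S : E →ₗ.[ℂ] E) : LinearMap.ker (jEmb S).toFun = ⊥ :=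
  ker_toFun_eq_bot_of_injective (injective_jEmb S)

variable [CompleteSpace E]

theorem zeroNotEigenvalue_of_isPositiveSqrt {H S : E →ₗ.[ℂ] E} (hS : IsPositiveSqrt H S)
    (hH : ZeroNotEigenvalue H) : ZeroNotEigenvalue S := by
  intro x hx
  have h : ((x : E), (0 : E)) ∈ H.graph := by
    rw [← hS.2, mem_graph_pcomp_iff]
    exact ⟨0, by rw [← hx]; exact S.mem_graph x, S.graph.zero_mem⟩
  obtain ⟨u, hu, hu'⟩ := (LinearPMap.mem_graph_iff H).mp h
  exact Eq.trans hu.symm (hH u hu')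

/-- For selfadjoint `S`, the orthogonal complement of the range is the kernel. -/
theorem dense_range_of_zeroNotEigenvalue {S : E →ₗ.[ℂ] E} (hS : IsSelfAdjoint S)
    (h0 : ZeroNotEigenvalue S) : Dense (LinearMap.range S.toFun : Set E) := by
  rw [Submodule.dense_iff_topologicalClosure_eq_top, Submodule.topologicalClosure_eq_top_iff,
    Submodule.eq_bot_iff]
  intro w hw
  have h : (w, (0 : E)) ∈ S.graph := by
    rw [mem_graph_iff_of_isSelfAdjoint hS]
    intro a b hab
    obtain ⟨u, rfl, rfl⟩ := (LinearPMap.mem_graph_iff S).mp hab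
    rw [inner_zero_right]
    exact hw _ ⟨u, rfl⟩
  obtain ⟨u, rfl, hu⟩ := (LinearPMap.mem_graph_iff S).mp h
  exact h0 u hu

variable {S : E →ₗ.[ℂ] E} (hS : IsSelfAdjoint S) (h0 : ZeroNotEigenvalue S)

include hS h0

theorem isCloseEmbedding_iEmb : IsCloseEmbedding (iEmb S) where
  injective := injective_iEmb S
  dense_domain := dense_domain_onCompletion _
  closed := isClosed_onCompletion _ (DPre.mapₗᵢ S) hS.isClosed fun _ _ =>
    mem_graph_iff_exists_DPre h0

theorem dense_range_iEmb : Dense (Set.range (iEmb S)) := by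
  rw [iEmb, range_onCompletion]
  refine hS.dense_domain.mono fun x hx => ?_
  obtain ⟨v, hv, -⟩ := (mem_graph_iff_exists_DPre h0).mp (S.mem_graph ⟨x, hx⟩)
  exact ⟨v, hv⟩

theorem isCloseEmbedding_inverse_jEmb : IsCloseEmbedding (jEmb S).inverse where
  injective := by
    intro u v huv
    have hu := (mem_graph_inverse_iff (ker_jEmb_eq_bot S)).mp (LinearPMap.mem_graph _ u)
    have hv := (mem_graph_inverse_iff (ker_jEmb_eq_bot S)).mp (LinearPMap.mem_graph _ v)
    exact Subtype.ext ((jEmb S).mem_graph_snd_inj hu hv huv)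
  dense_domain := by
    rw [LinearPMap.inverse_domain]
    refine (dense_range_of_zeroNotEigenvalue hS h0).mono ?_
    rintro _ ⟨u, rfl⟩
    obtain ⟨v, hv, -⟩ := (mem_graph_iff_exists_RPre h0).mp (S.mem_graph u)
    have : S u ∈ Set.range (jEmb S) := by rw [jEmb, range_onCompletion]; exact ⟨v, hv⟩
    exact this
  closed := by
    rw [LinearPMap.inverse_closed_iff (ker_jEmb_eq_bot S)]
    refine isClosed_onCompletion _ (RPre.preimageₗᵢ S) (C := Prod.swap ⁻¹' (S.graph : Set (E × E)))
      (hS.isClosed.preimage continuous_swap) fun _ _ => mem_graph_iff_exists_RPre h0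

/-- Testing `w` against `Dom S` in `𝒟(S)` is testing its image under the extended isometry against
`Ran S`, so selfadjointness identifies `i_S^*` with `S⁻¹`, up to that isometry. -/
theorem mem_graph_adjoint_iEmb_iff {z : E} {w : DSpace S} :
    (z, w) ∈ (iEmb S).adjoint.graph ↔ (completionExtend (DPre.mapₗᵢ S) w, z) ∈ S.graph := by
  refine (mem_graph_adjoint_onCompletion_iff (DPre.incl S) (DPre.mapₗᵢ S)).trans ?_
  rw [mem_graph_iff_of_isSelfAdjoint hS]
  constructor
  · intro h a b hab
    obtain ⟨v, rfl, rfl⟩ := (mem_graph_iff_exists_DPre h0).mp hab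
    exact h v
  · exact fun h v => h _ _ ((mem_graph_iff_exists_DPre h0).mpr ⟨v, rfl, rfl⟩)

/-- Write `y = S p`, so that `p` carries the norm of `y` in `ℛ(S)`. The quotients become `|⟨S d, p⟩|
/ ‖S d‖`, and `Ran S` is dense. -/
theorem isLUB_inverse_jEmb (y : (jEmb S).inverse.domain) :
    IsLUB {r : ℝ≥0 | ∃ x : (iEmb S).domain, (x : DSpace S) ≠ 0 ∧
      r = ‖inner ℂ (iEmb S x) (y : E)‖₊ / ‖(x : DSpace S)‖₊} ‖(jEmb S).inverse y‖₊ := by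
  have hy := (mem_graph_inverse_iff (ker_jEmb_eq_bot S)).mp (LinearPMap.mem_graph _ y)
  obtain ⟨v, hv, hvy⟩ := mem_graph_onCompletion_iff.mp hy
  have hp : (RPre.preimageₗᵢ S v, (y : E)) ∈ S.graph :=
    (mem_graph_iff_exists_RPre h0).mpr ⟨v, hvy, rfl⟩
  have hn : ‖(jEmb S).inverse y‖₊ = ‖RPre.preimageₗᵢ S v‖₊ := by
    rw [← hv, Completion.nnnorm_coe, LinearIsometry.nnnorm_map]
  rw [hn]
  convert isLUB_nnnorm_inner_div (dense_range_of_zeroNotEigenvalue hS h0)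
    (RPre.preimageₗᵢ S v) using 1
  have key : ∀ a b, (a, b) ∈ S.graph →
      inner ℂ b (RPre.preimageₗᵢ S v) = inner ℂ a (y : E) := fun a b hab =>
    inner_eq_of_isSelfAdjoint hS hp hab
  ext r
  constructor
  · rintro ⟨x, hx, rfl⟩
    obtain ⟨u, hu, hux⟩ := mem_graph_onCompletion_iff.mp ((iEmb S).mem_graph x)
    have hg := (mem_graph_iff_exists_DPre h0).mpr ⟨u, rfl, rfl⟩
    rw [← hux, ← key _ _ hg, ← hu, Completion.nnnorm_coe, ← (DPre.mapₗᵢ S).nnnorm_map]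
    refine ⟨_, ⟨⟨u.1, u.2.1⟩, rfl⟩, fun h => hx ?_, rfl⟩
    have : u = 0 := (DPre.mapₗᵢ S).injective (h.trans (map_zero (DPre.mapₗᵢ S)).symm)
    rw [← hu, this, Completion.coe_zero]
  · rintro ⟨_, ⟨d, rfl⟩, hd, rfl⟩
    obtain ⟨u, hu, hu'⟩ := (mem_graph_iff_exists_DPre h0).mp (S.mem_graph d)
    have hi : ((u : DSpace S), (d : E)) ∈ (iEmb S).graph :=
      mem_graph_onCompletion_iff.mpr ⟨u, rfl, hu⟩
    obtain ⟨x, hx, hxd⟩ := (LinearPMap.mem_graph_iff _).mp hi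
    have hnorm : ‖(x : DSpace S)‖₊ = ‖S d‖₊ := by
      rw [hx, Completion.nnnorm_coe, ← (DPre.mapₗᵢ S).nnnorm_map, hu']
    refine ⟨x, fun h => hd ?_, ?_⟩
    · rw [h, nnnorm_zero] at hnorm
      exact nnnorm_eq_zero.mp hnorm.symm
    · rw [hnorm, hxd, ← key _ _ (S.mem_graph d)]
      rfl

theorem isTriplet_iEmb_jEmb : IsTriplet (iEmb S) (jEmb S).inverse where
  plus_embedding := isCloseEmbedding_iEmb hS h0
  plus_dense_range := dense_range_iEmb hS h0
  minus_embedding := isCloseEmbedding_inverse_jEmb hS h0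
  minus_dense_range := by
    have h : Set.range (jEmb S).inverse = (jEmb S).domain :=
      congrArg SetLike.coe (LinearPMap.inverse_range (ker_jEmb_eq_bot S))
    rw [h]
    exact dense_domain_onCompletion _
  adjoint_domain_le y hy := by
    obtain ⟨k, hk⟩ := LinearPMap.mem_domain_iff.mp hy
    -- Elements of `Dom i_S^*` lie in `Ran S`, which is the domain of `j_S⁻¹`.
    have hx := (mem_graph_adjoint_iEmb_iff hS h0).mp hk
    obtain ⟨v, hv, -⟩ := (mem_graph_iff_exists_RPre h0).mp hx
    have h : y ∈ Set.range (jEmb S) := by rw [jEmb, range_onCompletion]; exact ⟨v, hv⟩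
    rw [LinearPMap.inverse_domain]
    exact h
  dual_norm := isLUB_inverse_jEmb hS h0

theorem hamiltonian_iEmb : hamiltonian (iEmb S) = pcomp S S := by
  apply LinearPMap.eq_of_eq_graph
  ext ⟨x, z⟩
  rw [mem_graph_hamiltonian_iff (isCloseEmbedding_iEmb hS h0) (dense_range_iEmb hS h0),
    mem_graph_pcomp_iff]
  have key : ∀ u : DPre S, (z, (u : DSpace S)) ∈ (iEmb S).adjoint.graph ↔
      (DPre.mapₗᵢ S u, z) ∈ S.graph := fun u => by
    rw [mem_graph_adjoint_iEmb_iff hS h0, completionExtend_coe]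
  constructor
  · rintro ⟨w, hw, hz⟩
    obtain ⟨u, rfl, rfl⟩ := mem_graph_onCompletion_iff.mp hw
    exact ⟨_, (mem_graph_iff_exists_DPre h0).mpr ⟨u, rfl, rfl⟩, (key u).mp hz⟩
  · rintro ⟨k, hk, hz⟩
    obtain ⟨u, rfl, rfl⟩ := (mem_graph_iff_exists_DPre h0).mp hk
    exact ⟨u, mem_graph_onCompletion_iff.mpr ⟨u, rfl, rfl⟩, (key u).mpr hz⟩

end SqrtTriplet

end CloseEmb

end

/-! ### The theorem: the comparison applied to the model triplet and to an arbitrary one. -/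

open CloseEmb in
theorem theorem5p4 {H₀ : Type*} [NormedAddCommGroup H₀] [InnerProductSpace ℂ H₀]
    [CompleteSpace H₀] (H : H₀ →ₗ.[ℂ] H₀) (hH : IsPositiveSelfadjoint H)
    (hH0 : ZeroNotEigenvalue H) :
    -- the square root is well defined
    IsPositiveSqrt H (sqrt H) ∧
    -- (1)
    (IsTriplet (iEmb (sqrt H)) (jEmb (sqrt H)).inverse ∧ hamiltonian (iEmb (sqrt H)) = H) ∧
    -- (2)
    ∀ (Hp : Type*) [NormedAddCommGroup Hp] [InnerProductSpace ℂ Hp] [CompleteSpace Hp]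
      (Hm : Type*) [NormedAddCommGroup Hm] [InnerProductSpace ℂ Hm] [CompleteSpace Hm]
      (jp : Hp →ₗ.[ℂ] H₀) (jm : H₀ →ₗ.[ℂ] Hm),
      IsTriplet jp jm → hamiltonian jp = H →
      -- (a)
      (IsDenseVia (iEmb (sqrt H)) (sqrt H).domain ∧ IsDenseVia jp (sqrt H).domain) ∧
      -- (b)
      (∀ (x : (sqrt H).domain) (y : H.domain),
        (∀ u v : jp.domain, jp u = x → jp v = y →
          inner ℂ (x : H₀) (H y) = inner ℂ (u : Hp) (v : Hp)) ∧
        (∀ u v : (iEmb (sqrt H)).domain, iEmb (sqrt H) u = x → iEmb (sqrt H) v = y →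
          inner ℂ (x : H₀) (H y) = inner ℂ (u : DSpace (sqrt H)) (v : DSpace (sqrt H)))) ∧
      -- (c)
      (IsDenseVia (iEmb (sqrt H)) H.domain ∧ IsDenseVia jp H.domain) ∧
      -- (d)
      (Set.range jp = (sqrt H).domain ∧
        ∀ x : jp.domain,
          IsLUB {r : ℝ≥0 | ∃ z : (sqrt H).domain, (z : H₀) ≠ 0 ∧
            r = ‖inner ℂ (jp x) (sqrt H z)‖₊ / ‖(z : H₀)‖₊} ‖(x : Hp)‖₊) ∧
      -- (e)
      (∃ Φ : DSpace (sqrt H) ≃ₗᵢ[ℂ] Hp,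
        (∀ (y : H.domain) (u : (iEmb (sqrt H)).domain) (v : jp.domain),
          iEmb (sqrt H) u = y → jp v = y → Φ u = v) ∧
        (∀ Ψ : DSpace (sqrt H) →L[ℂ] Hp,
          (∀ (y : H.domain) (u : (iEmb (sqrt H)).domain) (v : jp.domain),
            iEmb (sqrt H) u = y → jp v = y → Ψ u = v) →
          ∀ w, Ψ w = Φ w) ∧
        (∀ (y : H.domain) (u : (iEmb (sqrt H)).domain), iEmb (sqrt H) u = y →
          ∃ h : H y ∈ jp.adjoint.domain, Φ u = jp.adjoint ⟨H y, h⟩)) := by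
  have hS := isPositiveSqrt_sqrt hH
  have h0 := zeroNotEigenvalue_of_isPositiveSqrt hS hH0
  have hi := isCloseEmbedding_iEmb hS.1.1 h0
  have hir := dense_range_iEmb hS.1.1 h0
  have hiH : hamiltonian (iEmb (sqrt H)) = H := (hamiltonian_iEmb hS.1.1 h0).trans hS.2
  refine ⟨hS, ⟨isTriplet_iEmb_jEmb hS.1.1 h0, hiH⟩, ?_⟩
  intro Hp _ _ _ Hm _ _ _ jp jm ht hjH
  have hj := ht.plus_embedding
  have hjr := ht.plus_dense_range
  have hdi := isDenseVia_domain_hamiltonian hi hir hiH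
  have hdj := isDenseVia_domain_hamiltonian hj hjr hjH
  refine ⟨⟨isDenseVia_domain_sqrt hi hir hiH hS, isDenseVia_domain_sqrt hj hjr hjH hS⟩,
    fun x y => ⟨fun u v hu hv => ?_, fun u v hu hv => ?_⟩, ⟨hdi, hdj⟩,
    ⟨range_eq_domain_sqrt hj hjr hjH hS, isLUB_inner_sqrt hj hjr hjH hS⟩, ?_⟩
  · exact inner_hamiltonian_eq hj hjr hjH (hu ▸ jp.mem_graph u) (hv ▸ jp.mem_graph v)
      (H.mem_graph y)
  · exact inner_hamiltonian_eq hi hir hiH (hu ▸ LinearPMap.mem_graph _ u)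
      (hv ▸ LinearPMap.mem_graph _ v) (H.mem_graph y)
  · obtain ⟨Φ, hΦ⟩ := exists_linearIsometryEquiv_of_range_eq hi.injective hj.injective
      hi.dense_domain hj.dense_domain
      ((range_eq_domain_sqrt hi hir hiH hS).trans (range_eq_domain_sqrt hj hjr hjH hS).symm)
      (fun u v x hu hv => by
        obtain ⟨k, hk, hn⟩ := exists_mem_graph_sqrt_of_mem_graph hi hir hiH hS hu
        rw [← hn, norm_eq_norm_sqrt hj hjr hjH hS hv hk])
    refine ⟨Φ, fun y u v hu hv => ?_, fun Ψ hΨ w => ?_, fun y u hu => ?_⟩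
    · exact hΦ _ _ y (hu ▸ LinearPMap.mem_graph _ u) (hv ▸ jp.mem_graph v)
    -- Two continuous maps agreeing on the copy of `Dom H`, dense in `𝒟(H^{1/2})` by (c), are equal.
    · refine hdi.2.induction (P := fun w => Ψ w = Φ w) (fun u hu => ?_)
        (isClosed_eq Ψ.continuous Φ.continuous) w
      obtain ⟨hu, huH⟩ := hu
      obtain ⟨v, hv⟩ := hdj.1 huH
      rw [hΨ ⟨_, huH⟩ ⟨u, hu⟩ v rfl hv]
      exact (hΦ _ _ _ (LinearPMap.mem_graph _ ⟨u, hu⟩) (hv ▸ jp.mem_graph v)).symm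
    · have hy : ((y : H₀), H y) ∈ (hamiltonian jp).graph := by
        rw [hjH]; exact H.mem_graph y
      obtain ⟨k, hk, hz⟩ := (mem_graph_hamiltonian_iff hj hjr).mp hy
      have h := LinearPMap.mem_domain_of_mem_graph hz
      refine ⟨h, ?_⟩
      -- The element `k` is both the preimage of `y` under `jp` and the value of `jp^*` at `H y`.
      rw [hΦ _ _ y (hu ▸ LinearPMap.mem_graph _ u) hk]
      exact (LinearPMap.image_iff h).mpr hz
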